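/- For integers $\mu>0$, rationals $d>1$ and $v$, and $\mathsf R\in\{<,>,\le,\ge,=,\ne\}$, let $\mathcal L(\mu,d,\mathsf R,v)$ be the set of infinite words $A=A_0A_1\dots$ over the alphabet $\{-\mu,\dots,\mu\}$ with $\mathrm{DS}_d(A)\ \mathsf R\ v$, where $\mathrm{DS}_d(A)=\sum_{i\ge 0}A_i/d^i$. A language of infinite words is $\omega$-regular if some (finite, nondeterministic) Büchi automaton accepts it. A Büchi automaton is deterministic if each state has at most one successor under each letter. A safety language is one for which every word outside it has a finite prefix none of whose infinite extensions lies in it; a co-safety language is the complement of a safety language. A safety (co-safety) automaton is a Büchi automaton that accepts a safety (co-safety) language and all of whose non-accepting (accepting) states are sinks, i.e. every letter leads from such a state back to that state only. A rational $v$ has an $n$-length representation in base $d$ if $v=\mathrm{DS}_d\bigl(w_0\dots w_{m-1}(w_m\dots w_{n-1})^{\omega}\bigr)$ for some $0\le m<n$ and integers $w_0,\dots,w_{n-1}$. 1. Let $d>1$ be rational, $\mathsf R$ one of the six relations, and $v\in\mathbb Q$. The comparison languages $\mathcal L(\mu,d,\mathsf R,v)$, $\mu=1,2,\dots$, are all $\omega$-regular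 if and only if $d$ is an integer. Moreover, for each single $\mu>0$ with $d-1\le\mu$ and $|v|<\mu d/(d-1)$, the language $\mathcal L(\mu,d,\mathsf R,v)$ is $\omega$-regular if and only if $d$ is an integer. 2. There is an absolute constant $C$ such that, for all integers $\mu>0$ and $d>1$, all $\mathsf R$, and all $v\in\mathbb Q$ with an $n$-length representation in base $d$, the language $\mathcal L(\mu,d,\mathsf R,v)$ is accepted by a deterministic Büchi automaton with at most $C\cdot n\cdot\max\{1,\mu/(d-1)\}$ states, which is a safety automaton if $\mathsf R\in\{\le,\ge,=\}$ and a co-safety automaton if $\mathsf R\in\{<,>,\ne\}$. In particular the number of states is $O(\mu n/(d-1))$ when $d-1\le\mu$. -/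

import Mathlib

namespace DSComparator

/-! ### Büchi automata and omega-regular languages -/

/-- A (nondeterministic) Büchi automaton over the alphabet `α`, with finitely many states. -/
structure BuchiAutomaton (α : Type) where
  State : Type
  finite : Finite State
  init : State
  trans : Set (State × α × State)
  accept : Set State

namespace BuchiAutomaton

variable {α : Type}

/-- The number of states (the state space is finite by assumption). -/
noncomputable def numStates (A : BuchiAutomaton α) : ℕ := Nat.card A.State

/-- `ρ` is a run of `A` on the infinite word `w`. -/
def IsRun (A : BuchiAutomaton α) (w : ℕ → α) (ρ : ℕ → A.State) : Prop :=
  ρ 0 = A.init ∧ ∀ i, (ρ i, w i, ρ (i + 1)) ∈ A.trans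

/-- The set of states that occur infinitely often in `ρ`. -/
def infStates (A : BuchiAutomaton α) (ρ : ℕ → A.State) : Set A.State :=
  {s | {i : ℕ | ρ i = s}.Infinite}

/-- The set of infinite words that have an accepting run. -/
def language (A : BuchiAutomaton α) : Set (ℕ → α) :=
  {w | ∃ ρ, A.IsRun w ρ ∧ (A.infStates ρ ∩ A.accept).Nonempty}

/-- Every state has at most one successor under each letter. -/
def IsDeterministic (A : BuchiAutomaton α) : Prop :=
  ∀ (s : A.State) (a : α), {t | (s, a, t) ∈ A.trans}.Subsingleton

/-- A state that every letter leads back to itself, and to no other state. -/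
def IsSink (A : BuchiAutomaton α) (s : A.State) : Prop :=
  ∀ (a : α) (t : A.State), (s, a, t) ∈ A.trans ↔ t = s

end BuchiAutomaton

/-- A language of infinite words is omega-regular if some Büchi automaton accepts it. -/
def IsOmegaRegular {α : Type} (L : Set (ℕ → α)) : Prop :=
  ∃ A : BuchiAutomaton α, A.language = L

/-! ### Safety and co-safety -/

/-- The infinite word `x · y`. -/
def appendWord {α : Type} (x : List α) (y : ℕ → α) : ℕ → α :=
  fun i => if h : i < x.length then x[i] else y (i - x.length)

/-- The prefix of length `k` of an infinite word. -/
def wordPrefix {α : Type} (w : ℕ → α) (k : ℕ) : List α :=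
  List.ofFn (fun i : Fin k => w i)

/-- No infinite extension of the finite word `x` is in `L`. -/
def IsBadPrefix {α : Type} (L : Set (ℕ → α)) (x : List α) : Prop :=
  ∀ y : ℕ → α, appendWord x y ∉ L

/-- Every word outside `L` has a bad prefix for `L`. -/
def IsSafetyLanguage {α : Type} (L : Set (ℕ → α)) : Prop :=
  ∀ w, w ∉ L → ∃ k, IsBadPrefix L (wordPrefix w k)

/-- The complement of a safety language. -/
def IsCoSafetyLanguage {α : Type} (L : Set (ℕ → α)) : Prop :=
  IsSafetyLanguage Lᶜ

/-- A safety automaton: it represents a safety language, and its non-accepting states are sinks. -/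
def BuchiAutomaton.IsSafetyAutomaton {α : Type} (A : BuchiAutomaton α) : Prop :=
  IsSafetyLanguage A.language ∧ ∀ s, s ∉ A.accept → A.IsSink s

/-- A co-safety automaton: it represents a co-safety language, and its accepting states are
sinks. -/
def BuchiAutomaton.IsCoSafetyAutomaton {α : Type} (A : BuchiAutomaton α) : Prop :=
  IsCoSafetyLanguage A.language ∧ ∀ s, s ∈ A.accept → A.IsSink s

/-! ### Discounted sums and comparison languages -/

/-- The discounted sum `A 0 + A 1 / d + A 2 / d ^ 2 + ⋯`. For `1 < d` and a bounded sequence,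
the only case in which it is used, the series converges absolutely. -/
noncomputable def dSum (d : ℚ) (A : ℕ → ℤ) : ℝ :=
  ∑' i, (A i : ℝ) / (d : ℝ) ^ i

/-- The six equality and inequality relations. -/
inductive CmpRel where
  | lt | gt | le | ge | eq | ne

/-- The binary relation on the reals that a symbol stands for. -/
def CmpRel.Holds : CmpRel → ℝ → ℝ → Prop
  | .lt, x, y => x < y
  | .gt, x, y => x > y
  | .le, x, y => x ≤ y
  | .ge, x, y => x ≥ y
  | .eq, x, y => x = y
  | .ne, x, y => x ≠ y

/-- The alphabet `{-μ, …, μ}`. -/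
abbrev Letter (μ : ℕ) : Type := Set.Icc (-(μ : ℤ)) (μ : ℤ)

/-- The comparison language with upper bound `μ`, discount factor `d`, relation `R` and
threshold value `v`. -/
def comparisonLanguage (μ : ℕ) (d : ℚ) (R : CmpRel) (v : ℚ) : Set (ℕ → Letter μ) :=
  {A | R.Holds (dSum d (fun i => (A i : ℤ))) (v : ℝ)}

/-- `v` has a representation of length `n` in base `d`: it is the discounted sum of an infinite
word of integers that consists of `m` digits followed by the endless repetition of a block of
`p > 0` digits, where `m + p = n`. -/
def HasRepresentation (d : ℚ) (v : ℚ) (n : ℕ) : Prop :=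
  ∃ (m p : ℕ) (w : ℕ → ℤ), 0 < p ∧ m + p = n ∧ (∀ i, m ≤ i → w (i + p) = w i) ∧
    dSum d w = (v : ℝ)

end DSComparator

open DSComparator

namespace DSComparator

/-! ### Discounted sums of bounded words -/

/-! Let `M = μ d / (d - 1)`. Comparing a word with `x` amounts to comparing its tail with `d (x -
a)`, where `a` is the first letter (`wordSum_sub_eq`), and the outcome is already known once the
threshold leaves `[-M, M]`. A deterministic automaton can therefore store the current threshold,
with one sink for each side. A run that never leaves `[-M, M]` forces equality, as the sum is then
within `2M / d^k` of `v` for every `k`. All that is needed is a set of thresholds that contains `v`,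
is closed under the steps, and is finite inside `[-M, M]` (`exists_threshold_automaton`).

For integer `d`, the multiples of `1 / v.den` form such a set. If `v` has a representation with tail
sums `T k`, so does the union of the classes `T k - dℤ`, `k < n`, each with at most `2M/d + 1 =
2μ/(d - 1) + 1` points in range.

Conversely, let a Büchi automaton accept the language, with `d - 1 ≤ μ` and `|v| < M`. Every
rational in `[-M, M]` is then a sum, so distinct thresholds have distinct languages, and only
finitely many thresholds are recognized by sets of states; these are closed under the steps that
stay in range. If `d` is not an integer, some prime `p` has `|d|_p > 1`. Finiteness makes all these
thresholds `p`-integral, yet one of them admits two consecutive letters, whose successors differ by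
`d` (`eq_int_of_finite_closed`). -/

/-- The largest discounted sum of a word over `{-μ, …, μ}`. -/
noncomputable def maxSum (μ : ℕ) (d : ℚ) : ℚ := μ * d / (d - 1)

/-- The infinite word `a · y`. -/
def prepend {α : Type} (a : α) (y : ℕ → α) : ℕ → α
  | 0 => a
  | i + 1 => y i

theorem maxSum_eq {μ : ℕ} {d : ℚ} (hd : 1 < d) : maxSum μ d = μ + maxSum μ d / d := by
  have h1 : d - 1 ≠ 0 := by linarith
  have h2 : d ≠ 0 := by linarith
  unfold maxSum
  field_simp
  ring

theorem maxSum_nonneg {μ : ℕ} {d : ℚ} (hd : 1 < d) : 0 ≤ maxSum μ d := by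
  have h1 : 0 ≤ d - 1 := by linarith
  have h2 : 0 ≤ d := by linarith
  unfold maxSum
  positivity

theorem hasSum_bound {c : ℝ} {d : ℚ} (hd : 1 < d) :
    HasSum (fun i : ℕ => c / (d : ℝ) ^ i) (c * d / (d - 1)) := by
  have hd' : (1 : ℝ) < d := by exact_mod_cast hd
  have h := (hasSum_geometric_of_lt_one (r := (d : ℝ)⁻¹) (by positivity)
    (inv_lt_one_of_one_lt₀ hd')).mul_left c
  have h1 : (d : ℝ) - 1 ≠ 0 := by linarith
  have h2 : (d : ℝ) ≠ 0 := by linarith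
  have e : (1 - (d : ℝ)⁻¹)⁻¹ = d / (d - 1) := by
    rw [← inv_div]
    congr 1
    field_simp
  rw [e, ← mul_div_assoc] at h
  simpa [inv_pow, div_eq_mul_inv] using h

theorem norm_term_le {c : ℝ} {d : ℚ} (hd : 1 < d) {w : ℕ → ℤ} (hw : ∀ i, |(w i : ℝ)| ≤ c) (i : ℕ) :
    ‖(w i : ℝ) / (d : ℝ) ^ i‖ ≤ c / (d : ℝ) ^ i := by
  have hd' : (0 : ℝ) < d := by exact_mod_cast (zero_lt_one.trans hd)
  rw [norm_div, Real.norm_eq_abs, Real.norm_of_nonneg (by positivity)]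
  gcongr
  exact hw i

theorem summable_terms {c : ℝ} {d : ℚ} (hd : 1 < d) {w : ℕ → ℤ} (hw : ∀ i, |(w i : ℝ)| ≤ c) :
    Summable (fun i => (w i : ℝ) / (d : ℝ) ^ i) :=
  Summable.of_norm_bounded (hasSum_bound hd).summable (norm_term_le hd hw)

theorem dSum_eq_add_tail {c : ℝ} {d : ℚ} (hd : 1 < d) {w : ℕ → ℤ} (hw : ∀ i, |(w i : ℝ)| ≤ c) :
    dSum d w = w 0 + dSum d (fun i => w (i + 1)) / d := by
  unfold dSum
  rw [(summable_terms hd hw).tsum_eq_zero_add, ← tsum_div_const]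
  simp [pow_succ, div_div]

theorem abs_letter_le {μ : ℕ} (a : Letter μ) : |((a : ℤ) : ℝ)| ≤ μ := by
  rw [abs_le]
  exact ⟨by exact_mod_cast a.2.1, by exact_mod_cast a.2.2⟩

/-- The discounted sum of a word over `{-μ, …, μ}`. -/
noncomputable def wordSum {μ : ℕ} (d : ℚ) (A : ℕ → Letter μ) : ℝ := dSum d (fun i => (A i : ℤ))

theorem abs_wordSum_le {μ : ℕ} {d : ℚ} (hd : 1 < d) (A : ℕ → Letter μ) :
    |wordSum d A| ≤ maxSum μ d := by
  have h := tsum_of_norm_bounded (hasSum_bound (c := μ) hd)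
    (norm_term_le hd (w := fun i => (A i : ℤ)) (fun i => abs_letter_le (A i)))
  rw [Real.norm_eq_abs] at h
  simpa [maxSum, wordSum, dSum] using h

theorem wordSum_eq_add_tail {μ : ℕ} {d : ℚ} (hd : 1 < d) (A : ℕ → Letter μ) :
    wordSum d A = (A 0 : ℤ) + wordSum d (fun i => A (i + 1)) / d :=
  dSum_eq_add_tail hd (w := fun i => (A i : ℤ)) (fun i => abs_letter_le (A i))

/-- The basic recursion: since `d > 0`, the sign of the difference survives the passage to the tail
with the new threshold. -/
theorem wordSum_sub_eq {μ : ℕ} {d : ℚ} (hd : 1 < d) (A : ℕ → Letter μ) (x : ℝ) :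
    wordSum d A - x = (wordSum d (fun i => A (i + 1)) - d * (x - (A 0 : ℤ))) / d := by
  have hd' : (d : ℝ) ≠ 0 := by exact_mod_cast (zero_lt_one.trans hd).ne'
  rw [wordSum_eq_add_tail hd A]
  field_simp
  ring

theorem eq_zero_of_abs_le_div_pow {d : ℚ} (hd : 1 < d) {x c : ℝ}
    (h : ∀ k : ℕ, |x| ≤ c / (d : ℝ) ^ k) : x = 0 := by
  have hd' : (1 : ℝ) < d := by exact_mod_cast hd
  have ht : Filter.Tendsto (fun k : ℕ => c / (d : ℝ) ^ k) Filter.atTop (nhds 0) :=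
    (hasSum_bound hd).summable.tendsto_atTop_zero
  have := ge_of_tendsto' ht h
  exact abs_eq_zero.mp (le_antisymm this (abs_nonneg x))

/-- If two words agree on their first `k` letters, their sums are close. -/
theorem abs_wordSum_sub_le {μ : ℕ} {d : ℚ} (hd : 1 < d) (k : ℕ) :
    ∀ A B : ℕ → Letter μ, (∀ i < k, A i = B i) →
      |wordSum d A - wordSum d B| ≤ 2 * maxSum μ d / (d : ℝ) ^ k := by
  have hd' : (0 : ℝ) < d := by exact_mod_cast (zero_lt_one.trans hd)
  induction k with
  | zero =>
    intro A B _
    have h1 := abs_wordSum_le hd A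
    have h2 := abs_wordSum_le hd B
    have h3 := abs_sub (wordSum d A) (wordSum d B)
    rw [pow_zero, div_one]
    linarith
  | succ k ih =>
    intro A B h
    have := ih (fun i => A (i + 1)) (fun i => B (i + 1)) (fun i hi => h (i + 1) (by omega))
    rw [wordSum_eq_add_tail hd A, wordSum_eq_add_tail hd B, h 0 (by omega), add_sub_add_left_eq_sub,
      ← sub_div, abs_div, abs_of_pos hd', pow_succ, ← div_div]
    gcongr

/-! ### Safety of comparison languages -/

theorem comparisonLanguage_eq (μ : ℕ) (d : ℚ) (R : CmpRel) (v : ℚ) :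
    comparisonLanguage μ d R v = {A | R.Holds (wordSum d A) v} := rfl

theorem appendWord_wordPrefix {α : Type} (w y : ℕ → α) (k i : ℕ) (hi : i < k) :
    appendWord (wordPrefix w k) y i = w i := by
  simp [appendWord, wordPrefix, hi]

/-- A prefix of length `k` fixes the sum up to `2M / d^k`, so a sum at positive distance from `S` is
kept out of `S` by a long enough prefix. -/
theorem isSafetyLanguage_of_isClosed {μ : ℕ} {d : ℚ} (hd : 1 < d) {S : Set ℝ} (hS : IsClosed S) :
    IsSafetyLanguage {A : ℕ → Letter μ | wordSum d A ∈ S} := by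
  intro w hw
  obtain ⟨ε, hε, hball⟩ := Metric.isOpen_iff.mp hS.isOpen_compl _ hw
  have ht : Filter.Tendsto (fun k : ℕ => 2 * (maxSum μ d : ℝ) / (d : ℝ) ^ k) Filter.atTop
      (nhds 0) := (hasSum_bound hd).summable.tendsto_atTop_zero
  obtain ⟨k, hk⟩ := (ht.eventually_lt_const hε).exists
  refine ⟨k, fun y hy => hball ?_ hy⟩
  rw [Metric.mem_ball, Real.dist_eq]
  exact (abs_wordSum_sub_le hd k _ _ (fun i hi => appendWord_wordPrefix w y k i hi)).trans_lt hk

theorem isSafetyLanguage_comparison {μ : ℕ} {d : ℚ} (hd : 1 < d) {R : CmpRel} {v : ℚ}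
    (hR : R = .le ∨ R = .ge ∨ R = .eq) : IsSafetyLanguage (comparisonLanguage μ d R v) := by
  rcases hR with rfl | rfl | rfl
  · exact isSafetyLanguage_of_isClosed hd (isClosed_Iic (a := (v : ℝ)))
  · exact isSafetyLanguage_of_isClosed hd (isClosed_Ici (a := (v : ℝ)))
  · exact isSafetyLanguage_of_isClosed hd (isClosed_singleton (x := (v : ℝ)))

theorem isCoSafetyLanguage_comparison {μ : ℕ} {d : ℚ} (hd : 1 < d) {R : CmpRel} {v : ℚ}
    (hR : R = .lt ∨ R = .gt ∨ R = .ne) : IsCoSafetyLanguage (comparisonLanguage μ d R v) := by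
  rcases hR with rfl | rfl | rfl
  · exact isSafetyLanguage_of_isClosed hd (isOpen_Iio (a := (v : ℝ))).isClosed_compl
  · exact isSafetyLanguage_of_isClosed hd (isOpen_Ioi (a := (v : ℝ))).isClosed_compl
  · exact isSafetyLanguage_of_isClosed hd (isOpen_compl_singleton (x := (v : ℝ))).isClosed_compl

/-! ### The threshold automaton -/

/-- Each relation depends only on the sign of `x - y`; `-1`, `0`, `1` serve as representatives,
matching `thresholdSign`. -/
theorem CmpRel.holds_of_lt (R : CmpRel) {x y : ℝ} (h : x < y) :
    R.Holds x y ↔ R.Holds (-1) 0 := by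
  cases R <;> simp [CmpRel.Holds, h, h.le, h.not_ge, h.not_gt, h.ne]

theorem CmpRel.holds_of_gt (R : CmpRel) {x y : ℝ} (h : y < x) :
    R.Holds x y ↔ R.Holds 1 0 := by
  cases R <;> simp [CmpRel.Holds, h, h.le, h.not_ge, h.not_gt, h.ne']

theorem CmpRel.holds_self (R : CmpRel) (x : ℝ) : R.Holds x x ↔ R.Holds 0 0 := by
  cases R <;> simp [CmpRel.Holds]

theorem CmpRel.holds_iff_of_sub_eq (R : CmpRel) {x y x' y' d : ℝ} (hd : 0 < d)
    (h : x - y = (x' - y') / d) : R.Holds x y ↔ R.Holds x' y' := by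
  rcases lt_trichotomy x' y' with h' | rfl | h'
  · have : x < y := by
      have := div_neg_of_neg_of_pos (sub_neg.mpr h') hd
      linarith
    rw [R.holds_of_lt this, R.holds_of_lt h']
  · have : x = y := by
      rw [sub_self, zero_div] at h
      linarith
    rw [this, R.holds_self, R.holds_self x']
  · have : y < x := by
      have := div_pos (sub_pos.mpr h') hd
      linarith
    rw [R.holds_of_gt this, R.holds_of_gt h']

/-- States of the threshold automaton: a threshold in `X` that the remaining word can still meet,
or one of two sinks (`true` once the sum is known to lie below the threshold, `false` above). -/
abbrev ThresholdState (X : Set ℝ) (μ : ℕ) (d : ℚ) : Type :=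
  ↥(X ∩ Set.Icc (-(maxSum μ d : ℝ)) (maxSum μ d)) ⊕ Bool

open Classical in
/-- The state that stands for the threshold `x`. -/
noncomputable def thresholdState (X : Set ℝ) (μ : ℕ) (d : ℚ) (x : ℝ) : ThresholdState X μ d :=
  if h : x ∈ X ∩ Set.Icc (-(maxSum μ d : ℝ)) (maxSum μ d) then .inl ⟨x, h⟩
  else .inr (decide (0 < x))

/-- The successor of a state under a letter. -/
noncomputable def thresholdNext {X : Set ℝ} {μ : ℕ} {d : ℚ} :
    ThresholdState X μ d → Letter μ → ThresholdState X μ d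
  | .inl x, a => thresholdState X μ d (d * ((x : ℝ) - (a : ℤ)))
  | .inr b, _ => .inr b

/-- The outcome of the comparison that a state stands for, as a sign. -/
def thresholdSign {X : Set ℝ} {μ : ℕ} {d : ℚ} : ThresholdState X μ d → ℝ
  | .inl _ => 0
  | .inr true => -1
  | .inr false => 1

/-- The deterministic automaton that keeps track of the threshold for the remaining word. -/
noncomputable def thresholdAutomaton (X : Set ℝ) (μ : ℕ) (d : ℚ) (R : CmpRel) (v : ℝ)
    (hfin : (X ∩ Set.Icc (-(maxSum μ d : ℝ)) (maxSum μ d)).Finite) :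
    BuchiAutomaton (Letter μ) where
  State := ThresholdState X μ d
  finite := by
    have := hfin.to_subtype
    infer_instance
  init := thresholdState X μ d v
  trans := {e | e.2.2 = thresholdNext e.1 e.2.1}
  accept := {s | R.Holds (thresholdSign s) 0}

/-- What a state reached after `k` letters says about the sum of the word. -/
def ThresholdState.Sound {X : Set ℝ} {μ : ℕ} {d : ℚ} (w : ℕ → Letter μ) (v : ℝ) (k : ℕ) :
    ThresholdState X μ d → Prop
  | .inl x => (x : ℝ) ∈ X ∧
      wordSum d w - v = (wordSum d (fun i => w (i + k)) - x) / (d : ℝ) ^ k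
  | .inr true => wordSum d w < v
  | .inr false => v < wordSum d w

/-- Tail sums lie in `[-M, M]`, so a threshold outside that interval settles the comparison. -/
theorem thresholdState_sound {X : Set ℝ} {μ : ℕ} {d : ℚ} (hd : 1 < d) {w : ℕ → Letter μ} {v x : ℝ}
    {k : ℕ} (hx : x ∈ X)
    (h : wordSum d w - v = (wordSum d (fun i => w (i + k)) - x) / (d : ℝ) ^ k) :
    (thresholdState X μ d x).Sound w v k := by
  have hd' : (0 : ℝ) < (d : ℝ) ^ k := pow_pos (by exact_mod_cast (zero_lt_one.trans hd)) k
  have hb := abs_le.mp (abs_wordSum_le hd (fun i => w (i + k)))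
  have hM : (0 : ℝ) ≤ maxSum μ d := by exact_mod_cast maxSum_nonneg hd
  unfold thresholdState
  split_ifs with hX
  · exact ⟨hx, h⟩
  · have hX' : ¬ (-(maxSum μ d : ℝ) ≤ x ∧ x ≤ maxSum μ d) := fun h' => hX ⟨hx, h'⟩
    by_cases h0 : 0 < x
    · have : (maxSum μ d : ℝ) < x := by
        by_contra hc
        exact hX' ⟨by linarith, not_lt.mp hc⟩
      have := div_neg_of_neg_of_pos (show wordSum d (fun i => w (i + k)) - x < 0 by linarith) hd'
      simp only [h0, decide_true, ThresholdState.Sound]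
      linarith
    · have : x < -(maxSum μ d : ℝ) := by
        by_contra hc
        exact hX' ⟨not_lt.mp hc, by linarith⟩
      have := div_pos (show 0 < wordSum d (fun i => w (i + k)) - x by linarith) hd'
      simp only [h0, decide_false, ThresholdState.Sound]
      linarith

/-- When acceptance of the visited states is eventually constant, the Büchi condition reads off that
constant; a state visited infinitely often exists by pigeonhole. -/
theorem BuchiAutomaton.accepting_iff {α : Type} (A : BuchiAutomaton α) (ρ : ℕ → A.State) (N : ℕ)
    (P : Prop) (h : ∀ k ≥ N, ρ k ∈ A.accept ↔ P) :
    (A.infStates ρ ∩ A.accept).Nonempty ↔ P := by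
  constructor
  · rintro ⟨s, hs, hacc⟩
    obtain ⟨k, hk, hNk⟩ := Set.Infinite.exists_gt hs N
    exact (h k hNk.le).mp (hk ▸ hacc)
  · intro hP
    have := A.finite
    obtain ⟨s, hs⟩ := Finite.exists_infinite_fiber ρ
    have hs' : {i | ρ i = s}.Infinite := Set.infinite_coe_iff.mp hs
    obtain ⟨k, hk, hNk⟩ := Set.Infinite.exists_gt hs' N
    exact ⟨s, hs', hk ▸ (h k hNk.le).mpr hP⟩

section Threshold

variable {X : Set ℝ} {μ : ℕ} {d : ℚ} {R : CmpRel} {v : ℚ}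
  (hfin : (X ∩ Set.Icc (-(maxSum μ d : ℝ)) (maxSum μ d)).Finite)

theorem thresholdAutomaton_run_accepting_iff (hd : 1 < d) (hv : (v : ℝ) ∈ X)
    (hX : ∀ x ∈ X, ∀ a : Letter μ, (d : ℝ) * (x - (a : ℤ)) ∈ X) (w : ℕ → Letter μ)
    (ρ : ℕ → ThresholdState X μ d) (h0 : ρ 0 = thresholdState X μ d v)
    (hρ : ∀ i, ρ (i + 1) = thresholdNext (ρ i) (w i)) :
    ((thresholdAutomaton X μ d R v hfin).infStates ρ ∩
      (thresholdAutomaton X μ d R v hfin).accept).Nonempty ↔ R.Holds (wordSum d w) v := by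
  have hd' : (0 : ℝ) < d := by exact_mod_cast (zero_lt_one.trans hd)
  have sound : ∀ k, (ρ k).Sound w v k := by
    intro k
    induction k with
    | zero =>
      rw [h0]
      exact thresholdState_sound hd hv (by simp)
    | succ k ih =>
      rw [hρ]
      rcases hk : ρ k with x | _ | _
      · rw [hk] at ih
        refine thresholdState_sound hd (hX _ ih.1 _) ?_
        rw [ih.2, wordSum_sub_eq hd, div_div, pow_succ']
        simp [add_assoc, add_comm 1 k]
      · rw [hk] at ih
        exact ih
      · rw [hk] at ih
        exact ih
  -- Either no sink is ever reached, and bounded thresholds force equality, or the run stays in a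
  -- sink that knows the strict inequality.
  by_cases hall : ∀ k, ∃ x, ρ k = .inl x
  · have heq : wordSum d w = v := by
      rw [← sub_eq_zero]
      refine eq_zero_of_abs_le_div_pow hd (c := 2 * maxSum μ d) fun k => ?_
      obtain ⟨x, hx⟩ := hall k
      have hs := sound k
      rw [hx] at hs
      rw [hs.2, abs_div, abs_of_pos (pow_pos hd' k)]
      gcongr
      have h1 := abs_wordSum_le hd (fun i => w (i + k))
      have h2 := abs_le.mpr x.2.2
      have h3 := abs_sub (wordSum d (fun i => w (i + k))) x
      linarith
    refine BuchiAutomaton.accepting_iff (thresholdAutomaton X μ d R v hfin) ρ 0 _ fun k _ => ?_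
    obtain ⟨x, hx⟩ := hall k
    rw [hx, heq, R.holds_self]
    rfl
  · push Not at hall
    obtain ⟨N, hN⟩ := hall
    rcases hb : ρ N with x | b
    · exact absurd hb (hN x)
    have hconst : ∀ k ≥ N, ρ k = .inr b := by
      intro k hk
      induction k, hk using Nat.le_induction with
      | base => exact hb
      | succ k _ ih => rw [hρ, ih]; rfl
    refine BuchiAutomaton.accepting_iff (thresholdAutomaton X μ d R v hfin) ρ N _ fun k hk => ?_
    have hs := sound k
    rw [hconst k hk] at hs ⊢
    cases b
    · rw [R.holds_of_gt hs]
      rfl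
    · rw [R.holds_of_lt hs]
      rfl

theorem thresholdAutomaton_language (hd : 1 < d) (hv : (v : ℝ) ∈ X)
    (hX : ∀ x ∈ X, ∀ a : Letter μ, (d : ℝ) * (x - (a : ℤ)) ∈ X) :
    (thresholdAutomaton X μ d R v hfin).language = comparisonLanguage μ d R v := by
  rw [comparisonLanguage_eq]
  ext w
  constructor
  · rintro ⟨ρ, ⟨h0, hρ⟩, hacc⟩
    exact (thresholdAutomaton_run_accepting_iff hfin hd hv hX w ρ h0 hρ).mp hacc
  · intro hw
    let ρ : ℕ → ThresholdState X μ d := fun k =>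
      Nat.rec (thresholdState X μ d v) (fun i s => thresholdNext s (w i)) k
    exact ⟨ρ, ⟨rfl, fun _ => rfl⟩,
      (thresholdAutomaton_run_accepting_iff hfin hd hv hX w ρ rfl fun _ => rfl).mpr hw⟩

theorem thresholdAutomaton_isDeterministic :
    (thresholdAutomaton X μ d R v hfin).IsDeterministic := by
  intro s a t ht t' ht'
  exact Eq.trans ht (Eq.symm ht')

theorem thresholdAutomaton_isSink_inr (b : Bool) :
    (thresholdAutomaton X μ d R v hfin).IsSink (.inr b) :=
  fun _ _ => Iff.rfl

theorem thresholdAutomaton_numStates :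
    (thresholdAutomaton X μ d R v hfin).numStates =
      (X ∩ Set.Icc (-(maxSum μ d : ℝ)) (maxSum μ d)).ncard + 2 := by
  have := hfin.to_subtype
  unfold BuchiAutomaton.numStates
  change Nat.card (ThresholdState X μ d) = _
  rw [Nat.card_sum, Nat.card_coe_set_eq]
  simp

theorem exists_threshold_automaton
    (hfin : (X ∩ Set.Icc (-(maxSum μ d : ℝ)) (maxSum μ d)).Finite) (hd : 1 < d) (hv : (v : ℝ) ∈ X)
    (hX : ∀ x ∈ X, ∀ a : Letter μ, (d : ℝ) * (x - (a : ℤ)) ∈ X) :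
    ∃ A : BuchiAutomaton (Letter μ),
      A.language = comparisonLanguage μ d R v ∧
      A.IsDeterministic ∧
      (R = .le ∨ R = .ge ∨ R = .eq → A.IsSafetyAutomaton) ∧
      (R = .lt ∨ R = .gt ∨ R = .ne → A.IsCoSafetyAutomaton) ∧
      A.numStates = (X ∩ Set.Icc (-(maxSum μ d : ℝ)) (maxSum μ d)).ncard + 2 := by
  have hL := thresholdAutomaton_language (R := R) hfin hd hv hX
  refine ⟨thresholdAutomaton X μ d R v hfin, hL, thresholdAutomaton_isDeterministic hfin,
    fun hR => ⟨hL ▸ isSafetyLanguage_comparison hd hR, ?_⟩,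
    fun hR => ⟨hL ▸ isCoSafetyLanguage_comparison hd hR, ?_⟩, thresholdAutomaton_numStates hfin⟩
  · rintro (x | b) hs
    -- Threshold states stand for equality, so they accept for these `R`; only sinks can reject.
    · refine absurd ?_ hs
      change R.Holds 0 0
      rcases hR with rfl | rfl | rfl <;> simp [CmpRel.Holds]
    · exact thresholdAutomaton_isSink_inr hfin b
  · rintro (x | b) hs
    · change R.Holds 0 0 at hs
      rcases hR with rfl | rfl | rfl <;> simp [CmpRel.Holds] at hs
    · exact thresholdAutomaton_isSink_inr hfin b

end Threshold

/-! ### Integer discount factors: regularity and size -/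

theorem finite_fractions_Icc {b : ℝ} (hb : 0 < b) (M : ℝ) :
    ({x : ℝ | ∃ c : ℤ, x = c / b} ∩ Set.Icc (-M) M).Finite := by
  refine ((Set.finite_Icc ⌈-M * b⌉ ⌊M * b⌋).image (fun c : ℤ => (c : ℝ) / b)).subset ?_
  rintro _ ⟨⟨c, rfl⟩, h1, h2⟩
  exact ⟨c, ⟨Int.ceil_le.mpr ((le_div_iff₀ hb).mp h1), Int.le_floor.mpr ((div_le_iff₀ hb).mp h2)⟩,
    rfl⟩

/-- Steps with integer `d` do not enlarge denominators, so all thresholds stay in `(1 / v.den) ℤ`.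
-/
theorem isOmegaRegular_comparison_of_int (μ : ℕ) {d : ℤ} (hd : 1 < d) (R : CmpRel) (v : ℚ) :
    IsOmegaRegular (comparisonLanguage μ d R v) := by
  have hb : (0 : ℝ) < v.den := by exact_mod_cast v.den_pos
  obtain ⟨A, hA, -⟩ := exists_threshold_automaton (R := R) (v := v) (d := (d : ℚ))
    (finite_fractions_Icc hb (maxSum μ d)) (by exact_mod_cast hd)
    ⟨v.num, by exact_mod_cast (Rat.num_div_den v).symm⟩
    (by
      rintro _ ⟨c, rfl⟩ a
      refine ⟨d * (c - a * v.den), ?_⟩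
      push_cast
      field_simp)
  exact ⟨A, hA⟩

/-- The digits of a representation need not lie in the alphabet; this bound makes the series of its
tails converge. -/
theorem exists_bound_of_periodic {m p : ℕ} {w : ℕ → ℤ} (hp : 0 < p)
    (hw : ∀ i, m ≤ i → w (i + p) = w i) : ∃ c : ℝ, ∀ i, |(w i : ℝ)| ≤ c := by
  refine ⟨∑ j ∈ Finset.range (m + p), |(w j : ℝ)|, fun i => ?_⟩
  induction i using Nat.strong_induction_on with
  | _ i ih =>
    by_cases hi : i < m + p
    · exact Finset.single_le_sum (f := fun j => |(w j : ℝ)|) (fun _ _ => abs_nonneg _)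
        (Finset.mem_range.mpr hi)
    · have h := hw (i - p) (by omega)
      rw [show i - p + p = i by omega] at h
      rw [h]
      exact ih (i - p) (by omega)

/-- The thresholds that differ from one of `T 0, …, T (n - 1)` by a multiple of `d`. -/
def shiftedThresholds (T : ℕ → ℝ) (d : ℝ) (n : ℕ) : Set ℝ :=
  {x | ∃ k < n, ∃ h : ℤ, x = T k - d * h}

open Classical in
-- For fixed `k`, the admissible `h` fill an interval of length `2M / d`, which holds at most `2M /
-- d + 1` integers.
theorem shiftedThresholds_Icc (T : ℕ → ℝ) {d M : ℝ} (hd : 0 < d) (hM : 0 ≤ M) (n : ℕ) :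
    (shiftedThresholds T d n ∩ Set.Icc (-M) M).Finite ∧
      ((shiftedThresholds T d n ∩ Set.Icc (-M) M).ncard : ℝ) ≤ n * (2 * (M / d) + 1) := by
  let F : ℕ → Finset ℝ := fun k =>
    (Finset.Icc ⌈(T k - M) / d⌉ ⌊(T k + M) / d⌋).image (fun h : ℤ => T k - d * h)
  have hsub : shiftedThresholds T d n ∩ Set.Icc (-M) M ⊆ ((Finset.range n).biUnion F : Set ℝ) := by
    rintro _ ⟨⟨k, hk, h, rfl⟩, h1, h2⟩
    simp only [Finset.coe_biUnion, Set.mem_iUnion]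
    refine ⟨k, by simpa using hk, ?_⟩
    refine Finset.mem_coe.mpr (Finset.mem_image.mpr ⟨h, Finset.mem_Icc.mpr ⟨?_, ?_⟩, rfl⟩)
    · rw [Int.ceil_le, div_le_iff₀ hd]
      linarith
    · rw [Int.le_floor, le_div_iff₀ hd]
      linarith
  have hF : ∀ k, ((F k).card : ℝ) ≤ 2 * (M / d) + 1 := by
    intro k
    have h1 : ((F k).card : ℝ) ≤ ((⌊(T k + M) / d⌋ + 1 - ⌈(T k - M) / d⌉).toNat : ℝ) := by
      rw [← Int.card_Icc]
      exact_mod_cast Finset.card_image_le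
    have h2 : ((⌊(T k + M) / d⌋ + 1 - ⌈(T k - M) / d⌉).toNat : ℝ) =
        ((max (⌊(T k + M) / d⌋ + 1 - ⌈(T k - M) / d⌉) 0 : ℤ) : ℝ) := by
      rw [← Int.toNat_eq_max, Int.cast_natCast]
    rw [h2] at h1
    refine h1.trans ?_
    push_cast
    refine max_le ?_ (by positivity)
    have h3 := Int.floor_le ((T k + M) / d)
    have h4 := Int.le_ceil ((T k - M) / d)
    linarith [add_div (T k) M d, sub_div (T k) M d]
  refine ⟨(Finset.finite_toSet _).subset hsub, ?_⟩
  have hcard : (shiftedThresholds T d n ∩ Set.Icc (-M) M).ncard ≤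
      ∑ k ∈ Finset.range n, (F k).card := by
    refine (Set.ncard_le_ncard hsub (Finset.finite_toSet _)).trans ?_
    rw [Set.ncard_coe_finset]
    exact Finset.card_biUnion_le
  calc ((shiftedThresholds T d n ∩ Set.Icc (-M) M).ncard : ℝ)
      ≤ ∑ k ∈ Finset.range n, ((F k).card : ℝ) := by exact_mod_cast hcard
    _ ≤ ∑ k ∈ Finset.range n, (2 * (M / d) + 1) := Finset.sum_le_sum fun k _ => hF k
    _ = n * (2 * (M / d) + 1) := by rw [Finset.sum_const, Finset.card_range, nsmul_eq_mul]

theorem exists_small_comparator (μ : ℕ) {d : ℤ} (hd : 1 < d) (R : CmpRel) (v : ℚ) (n : ℕ)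
    (hv : HasRepresentation d v n) :
    ∃ A : BuchiAutomaton (Letter μ),
      A.language = comparisonLanguage μ d R v ∧
      A.IsDeterministic ∧
      (R = .le ∨ R = .ge ∨ R = .eq → A.IsSafetyAutomaton) ∧
      (R = .lt ∨ R = .gt ∨ R = .ne → A.IsCoSafetyAutomaton) ∧
      (A.numStates : ℝ) ≤ 5 * (n * max 1 ((μ : ℝ) / ((d : ℝ) - 1))) := by
  obtain ⟨m, p, w, hp, rfl, hw, hsum⟩ := hv
  have hd1 : (1 : ℚ) < d := by exact_mod_cast hd
  have hdR : (1 : ℝ) < d := by exact_mod_cast hd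
  have hd0 : (0 : ℝ) < ((d : ℚ) : ℝ) := by exact_mod_cast (zero_lt_one.trans hd)
  obtain ⟨c, hc⟩ := exists_bound_of_periodic hp hw
  let T : ℕ → ℝ := fun k => dSum d (fun i => w (i + k))
  have hT : ∀ k, T (k + 1) = d * (T k - w k) := by
    intro k
    have h := dSum_eq_add_tail hd1 (w := fun i => w (i + k)) (fun i => hc (i + k))
    simp only [zero_add, add_assoc, add_comm 1 k] at h
    simp only [T]
    rw [h]
    push_cast
    have : (d : ℝ) ≠ 0 := by linarith
    field_simp
    ring
  have hTp : T (m + p) = T m := by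
    simp only [T]
    congr 1
    funext i
    rw [← add_assoc]
    exact hw _ (by omega)
  have hM : (0 : ℝ) ≤ maxSum μ d := by exact_mod_cast maxSum_nonneg hd1
  obtain ⟨hfin, hcard⟩ := shiftedThresholds_Icc T hd0 hM (m + p)
  obtain ⟨A, hL, hdet, hs, hcs, hnum⟩ := exists_threshold_automaton (R := R) (v := v) hfin hd1
    ⟨0, by omega, 0, by simp [T, hsum]⟩
    (by
      -- Modulo `dℤ`, a step just advances `k`; at the end of the period the index returns from `m +
      -- p` to `m`.
      rintro _ ⟨k, hk, h, rfl⟩ a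
      have key : ((d : ℚ) : ℝ) * (T k - (d : ℚ) * h - (a : ℤ)) =
          T (k + 1) - (d : ℚ) * ((d * h + a - w k : ℤ) : ℝ) := by
        rw [hT]
        push_cast
        ring
      by_cases hk' : k + 1 < m + p
      · exact ⟨k + 1, hk', _, key⟩
      · rw [show k + 1 = m + p by omega, hTp] at key
        exact ⟨m, by omega, _, key⟩)
  refine ⟨A, hL, hdet, hs, hcs, ?_⟩
  have hMd : (maxSum μ d : ℝ) / (d : ℚ) = μ / ((d : ℝ) - 1) := by
    have : (d : ℝ) - 1 ≠ 0 := by linarith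
    have : (d : ℝ) ≠ 0 := by linarith
    simp only [maxSum]
    push_cast
    field_simp
  rw [hMd] at hcard
  have hn : (1 : ℝ) ≤ ((m + p : ℕ) : ℝ) := by exact_mod_cast (by omega : 1 ≤ m + p)
  rw [hnum, Nat.cast_add, Nat.cast_two]
  generalize ((m + p : ℕ) : ℝ) = N at hn hcard ⊢
  -- The constant is `5 = 3 + 2`: three for the thresholds, two for the sinks.
  have h1 : N * (2 * (μ / ((d : ℝ) - 1)) + 1) ≤ N * (3 * max 1 (μ / ((d : ℝ) - 1))) := by
    gcongr
    linarith [le_max_left 1 ((μ : ℝ) / ((d : ℝ) - 1)), le_max_right 1 ((μ : ℝ) / ((d : ℝ) - 1))]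
  have h2 : 1 ≤ N * max 1 (μ / ((d : ℝ) - 1)) := one_le_mul_of_one_le_of_one_le hn (le_max_left _ _)
  linarith

/-! ### Every value between the extreme sums is a sum -/

theorem one_le_maxSum_div {μ : ℕ} {d : ℚ} (hd : 1 < d) (hμ : d - 1 ≤ μ) : 1 ≤ maxSum μ d / d := by
  have h1 : 0 < d - 1 := by linarith
  have h2 : d ≠ 0 := by linarith
  have : maxSum μ d / d = μ / (d - 1) := by
    unfold maxSum
    field_simp
  rw [this, le_div_iff₀ h1]
  linarith

theorem abs_mul_sub_le_iff {μ : ℕ} {d : ℚ} (hd : 1 < d) (x a : ℚ) :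
    |d * (x - a)| ≤ maxSum μ d ↔ x - maxSum μ d / d ≤ a ∧ a ≤ x + maxSum μ d / d := by
  have hd0 : 0 < d := by linarith
  rw [abs_mul, abs_of_pos hd0, mul_comm, ← le_div_iff₀ hd0, abs_le]
  constructor <;> rintro ⟨h1, h2⟩ <;> constructor <;> linarith

/-- The good letters are the integers of `[-μ, μ]` within `M / d ≥ 1` of `x`. As `|x| ≤ M = μ + M /
d`, the least integer of this window works unless the window starts at or below `-μ`, when `-μ`
does. -/
theorem exists_letter {μ : ℕ} {d : ℚ} (hd : 1 < d) (hμ : d - 1 ≤ μ) {x : ℚ}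
    (hx : |x| ≤ maxSum μ d) : ∃ a : Letter μ, |d * (x - (a : ℤ))| ≤ maxSum μ d := by
  have hB := one_le_maxSum_div hd hμ
  have hM := maxSum_eq (μ := μ) hd
  simp only [abs_mul_sub_le_iff hd]
  obtain ⟨h1, h2⟩ := abs_le.mp hx
  have hμ0 : (0 : ℚ) ≤ μ := Nat.cast_nonneg μ
  by_cases h : x - maxSum μ d / d ≤ -μ
  · refine ⟨⟨-μ, by constructor <;> omega⟩, ?_⟩
    push_cast
    constructor <;> linarith
  · have h3 := Int.le_ceil (x - maxSum μ d / d)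
    have h4 := Int.ceil_lt_add_one (x - maxSum μ d / d)
    refine ⟨⟨⌈x - maxSum μ d / d⌉, ?_, ?_⟩, h3, by simp only; linarith⟩
    · have : (-(μ : ℤ) : ℚ) ≤ ⌈x - maxSum μ d / d⌉ := by push_cast; linarith
      exact_mod_cast this
    · rw [Int.ceil_le]
      push_cast
      linarith

/-- The window has length at least `2`; lowering the bound on `|x|` by `1` leaves room in the
alphabet for a second letter. -/
theorem exists_consecutive_letters {μ : ℕ} {d : ℚ} (hd : 1 < d) (hμ : d - 1 ≤ μ) (hμ1 : 0 < μ)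
    {x : ℚ} (hx : |x| ≤ maxSum μ d - 1) :
    ∃ a b : Letter μ, (b : ℤ) = a + 1 ∧ |d * (x - (a : ℤ))| ≤ maxSum μ d ∧
      |d * (x - (b : ℤ))| ≤ maxSum μ d := by
  have hB := one_le_maxSum_div hd hμ
  have hM := maxSum_eq (μ := μ) hd
  simp only [abs_mul_sub_le_iff hd]
  obtain ⟨h1, h2⟩ := abs_le.mp hx
  have hμ0 : (0 : ℚ) ≤ μ := Nat.cast_nonneg μ
  by_cases h : x - maxSum μ d / d ≤ -μ
  · refine ⟨⟨-μ, by constructor <;> omega⟩, ⟨-μ + 1, by constructor <;> omega⟩, rfl, ?_⟩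
    push_cast
    refine ⟨⟨?_, ?_⟩, ?_, ?_⟩ <;> linarith
  · have h3 := Int.le_ceil (x - maxSum μ d / d)
    have h4 := Int.ceil_lt_add_one (x - maxSum μ d / d)
    have h5 : -(μ : ℤ) ≤ ⌈x - maxSum μ d / d⌉ := by
      have : (-(μ : ℤ) : ℚ) ≤ ⌈x - maxSum μ d / d⌉ := by push_cast; linarith
      exact_mod_cast this
    have h6 : ⌈x - maxSum μ d / d⌉ ≤ (μ : ℤ) - 1 := by
      rw [Int.ceil_le]
      push_cast
      linarith
    refine ⟨⟨⌈x - maxSum μ d / d⌉, h5, by omega⟩, ⟨⌈x - maxSum μ d / d⌉ + 1, by omega, by omega⟩,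
      rfl, ?_⟩
    push_cast
    refine ⟨⟨?_, ?_⟩, ?_, ?_⟩ <;> linarith

/-- Greedy expansion: letters are chosen so that every remainder stays in `[-M, M]`, and the error
after `k` letters is at most `2M / d^k`. -/
theorem exists_wordSum_eq {μ : ℕ} {d : ℚ} (hd : 1 < d) (hμ : d - 1 ≤ μ) {x : ℚ}
    (hx : |x| ≤ maxSum μ d) : ∃ y : ℕ → Letter μ, wordSum d y = x := by
  choose f hf using fun z : {z : ℚ // |z| ≤ maxSum μ d} => exists_letter hd hμ z.2
  let r : ℕ → {z : ℚ // |z| ≤ maxSum μ d} := fun k =>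
    Nat.rec ⟨x, hx⟩ (fun _ z => ⟨d * (z - (f z : ℤ)), hf z⟩) k
  have hd0 : (0 : ℝ) < d := by exact_mod_cast (zero_lt_one.trans hd)
  have key : ∀ k, wordSum d (fun i => f (r i)) - x =
      (wordSum d (fun i => f (r (i + k))) - (((r k).1 : ℚ) : ℝ)) / (d : ℝ) ^ k := by
    intro k
    induction k with
    | zero => simp [r]
    | succ k ih =>
      have hr : (((r (k + 1)).1 : ℚ) : ℝ) = d * ((((r k).1 : ℚ) : ℝ) - ((f (r k) : ℤ) : ℝ)) := by
        simp [r]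
      rw [ih, wordSum_sub_eq hd, hr, div_div, pow_succ']
      simp [add_assoc, add_comm 1 k]
  refine ⟨fun i => f (r i), sub_eq_zero.mp ?_⟩
  refine eq_zero_of_abs_le_div_pow hd (c := 2 * maxSum μ d) fun k => ?_
  rw [key, abs_div, abs_of_pos (pow_pos hd0 k)]
  gcongr
  have h1 := abs_wordSum_le hd (fun i => f (r (i + k)))
  have h2 : |(((r k).1 : ℚ) : ℝ)| ≤ maxSum μ d := by exact_mod_cast (r k).2
  have h3 := abs_sub (wordSum d (fun i => f (r (i + k)))) (((r k).1 : ℚ) : ℝ)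
  linarith

/-! ### Non-integer discount factors -/

/-- The automaton with another initial state. -/
def BuchiAutomaton.startAt {α : Type} (B : BuchiAutomaton α) (s : B.State) : BuchiAutomaton α :=
  { B with init := s }

theorem BuchiAutomaton.mem_infStates_shift {α : Type} (B : BuchiAutomaton α) (ρ : ℕ → B.State)
    (t : B.State) : t ∈ B.infStates (fun i => ρ (i + 1)) ↔ t ∈ B.infStates ρ := by
  simp only [infStates, Set.mem_ofPred_eq]
  rw [← Nat.frequently_atTop_iff_infinite, ← Nat.frequently_atTop_iff_infinite]
  conv_rhs => rw [← Filter.map_add_atTop_eq_nat 1, Filter.frequently_map]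

theorem BuchiAutomaton.prepend_mem_startAt {α : Type} (B : BuchiAutomaton α) (s : B.State) (a : α)
    (y : ℕ → α) : prepend a y ∈ (B.startAt s).language ↔
      ∃ t, (s, a, t) ∈ B.trans ∧ y ∈ (B.startAt t).language := by
  constructor
  · rintro ⟨ρ, ⟨h0, hρ⟩, t, ht, hacc⟩
    refine ⟨ρ 1, ?_, fun i => ρ (i + 1), ⟨rfl, fun i => hρ (i + 1)⟩, t,
      (B.mem_infStates_shift ρ t).mpr ht, hacc⟩
    have := hρ 0
    rw [h0] at this
    exact this
  · rintro ⟨t, hst, ρ, ⟨h0, hρ⟩, q, hq, hacc⟩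
    refine ⟨prepend s ρ, ⟨rfl, ?_⟩, q, (B.mem_infStates_shift (prepend s ρ) q).mp hq, hacc⟩
    rintro (_ | i)
    · change (s, a, ρ 0) ∈ B.trans
      rw [h0]
      exact hst
    · exact hρ i

/-- The thresholds in the range of the sums whose comparison language is the union of the languages
that `B` accepts from some set of states. -/
def recognizedThresholds {μ : ℕ} (B : BuchiAutomaton (Letter μ)) (d : ℚ) (R : CmpRel) : Set ℚ :=
  {x | |x| ≤ maxSum μ d ∧ ∃ S : Set B.State, ∀ y : ℕ → Letter μ,
    R.Holds (wordSum d y) x ↔ ∃ s ∈ S, y ∈ (B.startAt s).language}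

/-- Words whose sums are exactly `x` and `z` tell the two thresholds apart under every relation. -/
theorem CmpRel.not_lt_of_forall_iff {μ : ℕ} {d : ℚ} (hd : 1 < d) (hμ : d - 1 ≤ μ) (R : CmpRel)
    {x z : ℚ} (hx : |x| ≤ maxSum μ d) (hz : |z| ≤ maxSum μ d)
    (h : ∀ y : ℕ → Letter μ, R.Holds (wordSum d y) x ↔ R.Holds (wordSum d y) z) : ¬ x < z := by
  intro hlt
  obtain ⟨y, hy⟩ := exists_wordSum_eq hd hμ hx
  obtain ⟨y', hy'⟩ := exists_wordSum_eq hd hμ hz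
  have h1 := h y
  have h2 := h y'
  have hlt' : (x : ℝ) < z := by exact_mod_cast hlt
  rw [hy] at h1
  rw [hy'] at h2
  cases R <;>
    simp [CmpRel.Holds, hlt, hlt.le, hlt.not_ge, hlt.not_gt, hlt.ne] at h1 h2

theorem recognizedThresholds_finite {μ : ℕ} (B : BuchiAutomaton (Letter μ)) {d : ℚ} (hd : 1 < d)
    (hμ : d - 1 ≤ μ) (R : CmpRel) : (recognizedThresholds B d R).Finite := by
  have := B.finite
  choose S hS using fun x : recognizedThresholds B d R => x.2.2
  refine Set.finite_coe_iff.mp (Finite.of_injective S fun x z hxz => ?_)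
  have h : ∀ y : ℕ → Letter μ, R.Holds (wordSum d y) x.1 ↔ R.Holds (wordSum d y) z.1 := fun y => by
    rw [hS x y, hS z y, hxz]
  exact Subtype.ext (le_antisymm
    (not_lt.mp (R.not_lt_of_forall_iff hd hμ z.2.1 x.2.1 fun y => (h y).symm))
    (not_lt.mp (R.not_lt_of_forall_iff hd hμ x.2.1 z.2.1 h)))

/-- The subset construction: the new threshold is recognized by the `a`-successors of the old set of
states. -/
theorem recognizedThresholds_step {μ : ℕ} {B : BuchiAutomaton (Letter μ)} {d : ℚ} (hd : 1 < d)
    {R : CmpRel} {x : ℚ} (hx : x ∈ recognizedThresholds B d R) (a : Letter μ)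
    (ha : |d * (x - (a : ℤ))| ≤ maxSum μ d) : d * (x - (a : ℤ)) ∈ recognizedThresholds B d R := by
  have hd0 : (0 : ℝ) < d := by exact_mod_cast (zero_lt_one.trans hd)
  obtain ⟨-, S, hS⟩ := hx
  refine ⟨ha, {t | ∃ s ∈ S, (s, a, t) ∈ B.trans}, fun y => ?_⟩
  have h := hS (prepend a y)
  rw [R.holds_iff_of_sub_eq hd0 (wordSum_sub_eq hd (prepend a y) x)] at h
  simp only [BuchiAutomaton.prepend_mem_startAt] at h
  push_cast
  refine h.trans ?_
  constructor
  · rintro ⟨s, hs, t, hst, hy⟩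
    exact ⟨t, ⟨s, hs, hst⟩, hy⟩
  · rintro ⟨t, ⟨s, hs, hst⟩, hy⟩
    exact ⟨s, hs, t, hst, hy⟩

theorem exists_prime_padicNorm_gt_one {d : ℚ} (hd : ¬ ∃ k : ℤ, d = k) :
    ∃ p : ℕ, p.Prime ∧ 1 < padicNorm p d := by
  have hden : d.den ≠ 1 := fun h => hd ⟨d.num, ((Rat.den_eq_one_iff d).mp h).symm⟩
  obtain ⟨p, hp, hpd⟩ := Nat.exists_prime_and_dvd hden
  refine ⟨p, hp, ?_⟩
  have := Fact.mk hp
  have h1 : padicNorm p (d.den : ℤ) < 1 :=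
    (padicNorm.int_lt_one_iff _).mpr (Int.natCast_dvd_natCast.mpr hpd)
  have h2 : padicNorm p d.num = 1 := by
    refine (padicNorm.int_eq_one_iff _).mpr fun h => ?_
    have h3 := Nat.dvd_gcd (Int.natCast_dvd.mp h) hpd
    rw [d.reduced.gcd_eq_one] at h3
    exact hp.one_lt.ne' (Nat.dvd_one.mp h3)
  have h3 := padicNorm.mul (p := p) d (d.den : ℤ)
  rw [Int.cast_natCast, Rat.mul_den_eq_num, h2] at h3
  rw [Int.cast_natCast] at h1
  have h4 := padicNorm.nonneg (p := p) d
  have h5 := padicNorm.nonneg (p := p) (d.den : ℚ)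
  by_contra! h
  nlinarith

/-- A finite set of thresholds closed under the possible steps forces an integer discount factor. -/
theorem eq_int_of_finite_closed {μ : ℕ} {d : ℚ} (hd : 1 < d) (hμ : d - 1 ≤ μ) (hμ1 : 0 < μ)
    {Z : Set ℚ} (hZ : Z.Finite) (hZM : ∀ x ∈ Z, |x| ≤ maxSum μ d)
    (hstep : ∀ x ∈ Z, ∀ a : Letter μ, |d * (x - (a : ℤ))| ≤ maxSum μ d → d * (x - (a : ℤ)) ∈ Z)
    {v : ℚ} (hv : v ∈ Z) (hvM : |v| < maxSum μ d) : ∃ k : ℤ, d = k := by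
  by_contra hint
  obtain ⟨p, hp, hpd⟩ := exists_prime_padicNorm_gt_one hint
  have := Fact.mk hp
  have hnorm : ∀ x ∈ Z, padicNorm p x ≤ 1 := by
    -- If the largest norm exceeded `1`, subtracting an integer would preserve it and multiplying by
    -- `d` would increase it, contradicting maximality.
    obtain ⟨z, hz, hmax⟩ := hZ.exists_maximalFor (padicNorm p) Z ⟨v, hv⟩
    have hzmax : ∀ x ∈ Z, padicNorm p x ≤ padicNorm p z := fun x hx =>
      (le_total (padicNorm p x) (padicNorm p z)).elim id fun h => hmax hx h
    intro x hx
    refine (hzmax x hx).trans ?_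
    by_contra hgt
    push Not at hgt
    obtain ⟨a, ha⟩ := exists_letter hd hμ (hZM z hz)
    have hle := hzmax _ (hstep z hz a ha)
    have hint' := padicNorm.of_int (p := p) (-(a : ℤ))
    have heq : padicNorm p (z - (a : ℤ)) = padicNorm p z := by
      have hne : padicNorm p z ≠ padicNorm p ((-(a : ℤ) : ℤ) : ℚ) := by
        intro h
        linarith
      have := padicNorm.add_eq_max_of_ne hne
      rw [max_eq_left (by linarith)] at this
      rw [← this]
      push_cast
      rw [sub_eq_add_neg]
    rw [padicNorm.mul, heq] at hle
    nlinarith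
  -- The inequality must be strict: `M` and `-M` are fixed by the letters `μ` and `-μ`.
  obtain ⟨z, ⟨hz, hzM⟩, hmin⟩ :=
    (hZ.subset (Set.sep_subset Z fun x => |x| < maxSum μ d)).exists_minimalFor
      (fun x : ℚ => |x|) _ ⟨v, hv, hvM⟩
  have hM := maxSum_eq (μ := μ) hd
  have hB := one_le_maxSum_div hd hμ
  have hdM : d * (maxSum μ d / d) = maxSum μ d := by
    have : d ≠ 0 := by linarith
    field_simp
  have hMd : d ≤ maxSum μ d := by nlinarith
  have hz1 : |z| ≤ maxSum μ d - 1 := by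
    by_contra hgt
    push Not at hgt
    -- For `z ≥ 0`, the letter `μ` leads to `d (z - μ) = M - d (M - z)`. This is below `z` since `d
    -- > 1`, and positive since `M - z < 1` and `d ≤ M`. The other sign is symmetric.
    have hcontra : ∀ a : Letter μ, |d * (z - (a : ℤ))| < |z| → False := fun a ha =>
      (hmin (j := d * (z - (a : ℤ))) ⟨hstep z hz a (by linarith), by linarith⟩ ha.le).not_gt ha
    rcases abs_cases z with ⟨hz', hs⟩ | ⟨hz', hs⟩ <;> rw [hz'] at hgt hzM hcontra
    · refine hcontra ⟨μ, by constructor <;> omega⟩ (abs_lt.mpr ?_)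
      push_cast
      constructor <;> nlinarith
    · refine hcontra ⟨-μ, by constructor <;> omega⟩ (abs_lt.mpr ?_)
      push_cast
      constructor <;> nlinarith
  obtain ⟨a, b, hab, ha, hb⟩ := exists_consecutive_letters hd hμ hμ1 hz1
  have h1 := hnorm _ (hstep z hz a ha)
  have h2 := hnorm _ (hstep z hz b hb)
  have h3 := padicNorm.sub (p := p) (q := d * (z - (a : ℤ))) (r := d * (z - (b : ℤ)))
  have h4 : d * (z - (a : ℤ)) - d * (z - (b : ℤ)) = d := by
    rw [hab]
    push_cast
    ring
  rw [h4] at h3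
  linarith [max_le h1 h2]

theorem eq_int_of_isOmegaRegular {μ : ℕ} {d : ℚ} {R : CmpRel} {v : ℚ} (hμ1 : 0 < μ) (hd : 1 < d)
    (hμ : d - 1 ≤ μ) (hv : |v| < maxSum μ d) (h : IsOmegaRegular (comparisonLanguage μ d R v)) :
    ∃ k : ℤ, d = k := by
  obtain ⟨B, hB⟩ := h
  refine eq_int_of_finite_closed hd hμ hμ1 (recognizedThresholds_finite B hd hμ R)
    (fun x hx => hx.1) (fun x hx a ha => recognizedThresholds_step hd hx a ha)
    (v := v) ⟨hv.le, {B.init}, fun y => ?_⟩ hv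
  rw [comparisonLanguage_eq] at hB
  simp only [Set.mem_singleton_iff, exists_eq_left]
  exact (Set.ext_iff.mp hB y).symm

theorem isOmegaRegular_of_eq_int (μ : ℕ) {d : ℚ} (hd : 1 < d) (R : CmpRel) (v : ℚ)
    (h : ∃ k : ℤ, d = k) : IsOmegaRegular (comparisonLanguage μ d R v) := by
  obtain ⟨k, rfl⟩ := h
  exact isOmegaRegular_comparison_of_int μ (by exact_mod_cast hd) R v

theorem exists_large_alphabet {d : ℚ} (hd : 1 < d) (v : ℚ) :
    ∃ μ : ℕ, 0 < μ ∧ d - 1 ≤ μ ∧ |v| < maxSum μ d := by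
  obtain ⟨μ, hμ⟩ := exists_nat_gt (max (d - 1) |v|)
  obtain ⟨h1, h2⟩ := max_lt_iff.mp hμ
  -- `M = μ + M / d ≥ μ`, so `μ > |v|` suffices.
  have h3 : 0 ≤ maxSum μ d / d := div_nonneg (maxSum_nonneg hd) (by linarith)
  refine ⟨μ, ?_, h1.le, ?_⟩
  · have : (0 : ℚ) < μ := by linarith
    exact_mod_cast this
  · rw [maxSum_eq hd]
    linarith

end DSComparator

open DSComparator

theorem mainTheorem6 :
    -- omega-regularity, for a fixed relation and threshold and all upper bounds
    (∀ (d : ℚ) (R : CmpRel) (v : ℚ), 1 < d →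
      ((∀ μ : ℕ, 0 < μ → IsOmegaRegular (comparisonLanguage μ d R v)) ↔ ∃ k : ℤ, d = k)) ∧
    -- omega-regularity, for a fixed upper bound outside the degenerate cases
    (∀ (μ : ℕ) (d : ℚ) (R : CmpRel) (v : ℚ), 0 < μ → 1 < d → d - 1 ≤ μ →
      |v| < μ * d / (d - 1) →
      (IsOmegaRegular (comparisonLanguage μ d R v) ↔ ∃ k : ℤ, d = k)) ∧
    -- the size of the deterministic safety or co-safety comparator for integer discount factors
    (∃ C : ℝ, ∀ (μ : ℕ) (d : ℤ) (R : CmpRel) (v : ℚ) (n : ℕ), 0 < μ → 1 < d →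
      HasRepresentation d v n →
      ∃ A : BuchiAutomaton (Letter μ),
        A.language = comparisonLanguage μ d R v ∧
        A.IsDeterministic ∧
        (R = .le ∨ R = .ge ∨ R = .eq → A.IsSafetyAutomaton) ∧
        (R = .lt ∨ R = .gt ∨ R = .ne → A.IsCoSafetyAutomaton) ∧
        (A.numStates : ℝ) ≤ C * (n * max 1 ((μ : ℝ) / ((d : ℝ) - 1)))) := by
  refine ⟨fun d R v hd => ⟨fun h => ?_, fun h μ _ => isOmegaRegular_of_eq_int μ hd R v h⟩,
    fun μ d R v hμ hd hμd hv => ⟨fun h => ?_, fun h => isOmegaRegular_of_eq_int μ hd R v h⟩,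
    5, fun μ d R v n _ hd hv => exists_small_comparator μ hd R v n hv⟩
  · obtain ⟨μ, hμ, hμd, hv⟩ := exists_large_alphabet hd v
    exact eq_int_of_isOmegaRegular hμ hd hμd hv (h μ hμ)
  · exact eq_int_of_isOmegaRegular hμ hd hμd hv h
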